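/- Let $0\le d'<d$ be integers. Write $\|\cdot\|$ for the Euclidean norm of $\mathbb{R}^d$, $\mu_k$ for the Lebesgue measure on $\mathbb{R}^k$, $\omega_k$ for the volume of the unit ball of $\mathbb{R}^k$, $B(A,\rho)=\{y\in\mathbb{R}^d:\inf_{x\in A}\|y-x\|\le\rho\}$ for the parallel set of $A\subset\mathbb{R}^d$, and $d_H$ for the Hausdorff distance. Let $\mathcal{M}\subset\mathbb{R}^d$ be a non-empty compact set with $\mathrm{reach}(\mathcal{M})=R_0\in(0,\infty]$ (that is, $R_0=\inf_{x\in\mathcal{M}}\sup\{\rho>0:\text{every point of the open ball of centre }x\text{ and radius }\rho\text{ has a unique nearest point in }\mathcal{M}\}$), and suppose that its $d'$-dimensional Minkowski content $$L_0(\mathcal{M})=\lim_{\epsilon\to0^+}\frac{\mu_d(B(\mathcal{M},\epsilon))}{\omega_{d-d'}\,\epsilon^{d-d'}}$$ exists and is finite. Let $0<R_1<R_0$, $S=B(\mathcal{M},R_1)$, and let $Y_1,Y_2,\dots$ be independent random vectors with a common distribution whose support is $S$ and which is absolutely continuous with respect to $\mu_d$, with a density bounded from below on $S$ by a constant $f_0>0$.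 For each $n$ let $\hat S_n\subset\mathbb{R}^d$ and $\hat R_n\in\mathbb{R}$ be estimators based on $\mathcal{Y}_n=\{Y_1,\dots,Y_n\}$, and let $a_n\to0$ and $e_n\to0$ be deterministic sequences such that, almost surely, for all $n$ large enough, $\partial\hat S_n$ is non-empty and compact, $d_H(\partial\hat S_n,\partial S)<a_n$ and $|\hat R_n-R_1|\le e_n$. Fix $\lambda\in(0,1)$, let $\pi_{\partial\hat S_n}(y)$ denote a point of $\partial\hat S_n$ nearest to $y$ (any choice of it, if it is not unique), and define the denoised sample $$\mathcal{Z}_m=\Big\{\pi_{\partial\hat S_n}(Y_i)+\hat R_n\frac{Y_i-\pi_{\partial\hat S_n}(Y_i)}{\|Y_i-\pi_{\partial\hat S_n}(Y_i)\|}\;:\;1\le i\le n,\ d(Y_i,\partial\hat S_n)>\lambda\hat R_n\Big\}.$$ Let $\varepsilon_n=c(\log(n)/n)^{1/d}$ with $c>(6/(f_0\omega_d))^{1/d}$, and let $r_n>0$ be a deterministic sequence such that $r_n\to0$ and $\max(a_n^{1/3},e_n,\varepsilon_n)=o(r_n)$. Then $$\lim_{n\to\infty}\frac{\mu_d(B(\mathcal{Z}_m,r_n))}{\omega_{d-d'}\,r_n^{d-d'}}=L_0(\mathcal{M})\quad\text{almost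 surely.}$$ -/

import Mathlib

open MeasureTheory ProbabilityTheory Filter Topology Asymptotics

noncomputable section

namespace MinkowskiDenoising

/-- `ω_k`: the Lebesgue measure of the closed unit ball of `ℝ^k`. -/
def unitBallVolume (k : ℕ) : ℝ :=
  volume.real (Metric.closedBall (0 : EuclideanSpace ℝ (Fin k)) 1)

/-- `p` is a metric projection of `x` on `A`, i.e. a point of `A` nearest to `x`. -/
def IsMetricProjection {d : ℕ} (A : Set (EuclideanSpace ℝ (Fin d)))
    (x p : EuclideanSpace ℝ (Fin d)) : Prop :=
  p ∈ A ∧ ∀ q ∈ A, dist x p ≤ dist x q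

/-- `Unp(A)`: the points with a unique metric projection on `A`. -/
def unp {d : ℕ} (A : Set (EuclideanSpace ℝ (Fin d))) : Set (EuclideanSpace ℝ (Fin d)) :=
  {x | ∃! p, IsMetricProjection A x p}

/-- `reach(A, x) = sup {r > 0 : the open ball of centre x and radius r lies in Unp(A)}`, as an
extended nonnegative real number (`0` if there is no such `r`). -/
def localReach {d : ℕ} (A : Set (EuclideanSpace ℝ (Fin d)))
    (x : EuclideanSpace ℝ (Fin d)) : ENNReal :=
  ⨆ (r : ℝ) (_ : 0 < r) (_ : Metric.ball x r ⊆ unp A), ENNReal.ofReal r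

/-- `reach(A) = inf {reach(A, x) : x ∈ A}`; it is infinite e.g. for a closed convex set. -/
def reach {d : ℕ} (A : Set (EuclideanSpace ℝ (Fin d))) : ENNReal :=
  ⨅ x ∈ A, localReach A x

/-- The normalised volume `μ_d(B(A, r)) / (ω_{d-k} r^{d-k})` of the closed `r`-parallel set
`B(A, r) = {y : inf_{x ∈ A} ‖y - x‖ ≤ r}`. It is used for bounded `A`, `r > 0` and `k < d`. -/
def offsetRatio {d : ℕ} (k : ℕ) (A : Set (EuclideanSpace ℝ (Fin d))) (r : ℝ) : ℝ :=
  volume.real (Metric.cthickening r A) / (unitBallVolume (d - k) * r ^ (d - k))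

/-- The `k`-dimensional Minkowski content of the bounded set `A` exists, is finite, and equals
`L`. -/
def HasMinkowskiContent {d : ℕ} (k : ℕ) (A : Set (EuclideanSpace ℝ (Fin d))) (L : ℝ) : Prop :=
  Tendsto (fun r : ℝ => offsetRatio k A r) (𝓝[>] 0) (𝓝 L)

/-- The sample `(Y_1, …, Y_n)` formed by the first `n` terms of a sequence of random vectors. -/
def sample {Ω : Type*} {d : ℕ} (Y : ℕ → Ω → EuclideanSpace ℝ (Fin d)) (n : ℕ) (ω : Ω) :
    Fin n → EuclideanSpace ℝ (Fin d) :=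
  fun i => Y i ω

/-- The denoised sample obtained from the points `y_1, …, y_n`, the estimator `D` of the boundary
of the support, the estimator `R` of the noise level, the parameter `lam`, and the metric
projection `proj` on `D`: the points `y_i` with `d(y_i, D) > lam R` are kept, and each of them is
moved to the point at distance `R` from `proj y_i` in the direction of `y_i`. -/
def denoised {d n : ℕ} (D : Set (EuclideanSpace ℝ (Fin d))) (R lam : ℝ)
    (proj : EuclideanSpace ℝ (Fin d) → EuclideanSpace ℝ (Fin d))
    (y : Fin n → EuclideanSpace ℝ (Fin d)) : Set (EuclideanSpace ℝ (Fin d)) :=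
  {z | ∃ i, lam * R < Metric.infDist (y i) D ∧
    z = proj (y i) + (R / ‖y i - proj (y i)‖) • (y i - proj (y i))}

end MinkowskiDenoising

end

open MinkowskiDenoising

/-! ### Growth of the distance function below the reach, and the distance to the boundary of a
parallel set. -/

section Geometry

/-! The normalised volume at radius `r` does not see perturbations of size `o(r)`: if `Z` and `M`
lie in each other's `δ`-parallel sets and `δ = o(r)`, then `B(M, r - δ) ⊆ B(Z, r) ⊆ B(M, r + δ)`,
and both outer volumes have the same normalised limit (`tendsto_offsetRatio_of_subset_cthickening`).
It therefore suffices that the denoised sample and `M` are within `O(max(a^{1/3}, e, ε))` of each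
other.

From the sample to `M`: below the reach, a point `y` at distance `t > 0` from `M`, with projection
`p`, is within `R - t` of `∂S` (`infDist_frontier_cthickening_le`). A true boundary point `q` close
to the estimated projection of `y` then almost minimises the distance to `y`, while lying outside
the open ball of centre `p` and radius `R`. With `u` the direction from `p` to `y`, this forces `‖q
- (p + R u)‖² = O(a / t)` (`mul_sq_norm_sub_le_of_almost_nearest`). If `t > a^{1/3}` the error is
`O(a^{1/3})`; if not, `y` is already close to `M` and is hardly moved (`norm_denoised_sub_le`).

From `M` to the sample: a net, a union bound and Borel–Cantelli put a sample point within `2ε` of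
every point of `M` (`ae_eventually_forall_exists_dist_le`). Such a sample point survives the
trimming and is hardly moved. -/

theorem mem_cthickening_iff_infDist_le {X : Type*} [PseudoMetricSpace X] {A : Set X}
    (hA : A.Nonempty) {δ : ℝ} (hδ : 0 ≤ δ) {x : X} :
    x ∈ Metric.cthickening δ A ↔ Metric.infDist x A ≤ δ := by
  rw [Metric.mem_cthickening_iff, Metric.infDist,
    ENNReal.le_ofReal_iff_toReal_le (Metric.infEDist_ne_top hA) hδ]

/-- A preconnected set which meets both `A` and its complement meets the boundary of `A`. -/
theorem IsPreconnected.inter_frontier_nonempty {X : Type*} [TopologicalSpace X] {s A : Set X}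
    (hs : IsPreconnected s) {y z : X} (hys : y ∈ s) (hyA : y ∈ A) (hzs : z ∈ s) (hzA : z ∉ A) :
    (s ∩ frontier A).Nonempty := by
  by_contra hcon
  have hnf : ∀ x ∈ s, x ∉ frontier A := fun x hx hxf => hcon ⟨x, hx, hxf⟩
  have hcov : s ⊆ interior A ∪ (closure A)ᶜ := by
    intro x hx
    by_cases h : x ∈ closure A
    · left
      by_contra h'
      exact hnf x hx ⟨h, h'⟩
    · exact Or.inr h
  obtain ⟨x, -, hx1, hx2⟩ := hs _ _ isOpen_interior isClosed_closure.isOpen_compl hcov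
    ⟨y, hys, (hcov hys).resolve_right (fun h => h (subset_closure hyA))⟩
    ⟨z, hzs, (hcov hzs).resolve_left (fun h => hzA (interior_subset h))⟩
  exact hx2 (interior_subset_closure hx1)

variable {E : Type*} [NormedAddCommGroup E] [InnerProductSpace ℝ E]

/-- If `p` is the only metric projection of `y ∉ M` on `M`, then the distance to `M` grows at rate
almost one from `y` in the direction of `y - p`. -/
theorem eventually_lt_infDist_of_unique_projection {M : Set E} (hM : IsCompact M)
    (hMne : M.Nonempty) {y p : E} (hy : y ∉ M) (hpM : p ∈ M)
    (huniq : ∀ q ∈ M, dist y q = Metric.infDist y M → q = p) {η : ℝ} (hη : 0 < η) :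
    ∀ᶠ h in 𝓝[>] (0 : ℝ), Metric.infDist y M + (1 - η) * ‖h • (y - p)‖
      < Metric.infDist (y + h • (y - p)) M := by
  have hypos : 0 < ‖y - p‖ := norm_pos_iff.2 (sub_ne_zero.2 (fun h => hy (h ▸ hpM)))
  -- `φ q > 0` says that `y - q` makes with `y - p` an angle of cosine larger than `1 - η`.
  set φ : E → ℝ := fun q => inner ℝ (y - p) (y - q) - (1 - η) * ‖y - p‖ * ‖y - q‖ with hφ
  have hφc : Continuous φ := by fun_prop
  have hφp : 0 < φ p := by
    simp only [hφ, real_inner_self_eq_norm_mul_norm]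
    nlinarith [mul_pos hη (mul_pos hypos hypos)]
  -- By compactness and uniqueness of `p`, the points of `M` outside this cone are farther from `y`
  -- by a fixed margin, so a small move cannot make one of them nearest.
  have hgap : ∃ κ > 0, ∀ q ∈ M, φ q ≤ 0 → Metric.infDist y M + κ ≤ dist y q := by
    have hK : IsCompact (M ∩ {q | φ q ≤ 0}) :=
      hM.inter_right (isClosed_le hφc continuous_const)
    rcases (M ∩ {q | φ q ≤ 0}).eq_empty_or_nonempty with h0 | hne
    · refine ⟨1, one_pos, fun q hq hq' => ?_⟩
      have : q ∈ M ∩ {q | φ q ≤ 0} := ⟨hq, hq'⟩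
      simp [h0] at this
    · obtain ⟨q₀, hq₀, hmin⟩ := hK.exists_isMinOn hne
        (continuous_const.dist continuous_id : Continuous fun q => dist y q).continuousOn
      refine ⟨dist y q₀ - Metric.infDist y M, ?_, fun q hq hq' => ?_⟩
      · have h1 := Metric.infDist_le_dist_of_mem (x := y) hq₀.1
        rcases h1.lt_or_eq with h | h
        · exact sub_pos.2 h
        · have := huniq q₀ hq₀.1 h.symm
          have h2 : φ q₀ ≤ 0 := hq₀.2
          rw [this] at h2
          exact absurd hφp (not_lt.2 h2)
      · have := hmin (show q ∈ M ∩ {q | φ q ≤ 0} from ⟨hq, hq'⟩)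
        simp only [Set.mem_ofPred_eq] at this
        linarith
  obtain ⟨κ, hκ, hgap⟩ := hgap
  have hsmall : ∀ᶠ h in 𝓝[>] (0 : ℝ), h < κ / (2 * ‖y - p‖) :=
    nhdsWithin_le_nhds (Iio_mem_nhds (by positivity))
  filter_upwards [hsmall, self_mem_nhdsWithin] with h hh hh0
  replace hh0 : 0 < h := hh0
  set z := y + h • (y - p) with hz
  have hzy : z - y = h • (y - p) := by simp [hz]
  have hn : ‖h • (y - p)‖ = h * ‖y - p‖ := by rw [norm_smul, Real.norm_of_nonneg hh0.le]
  obtain ⟨q, hqM, hq⟩ := hM.exists_infDist_eq_dist hMne z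
  rw [hq, hn]
  have hyq : Metric.infDist y M ≤ dist y q := Metric.infDist_le_dist_of_mem hqM
  have hlt : h * ‖y - p‖ < κ / 2 := by
    rw [lt_div_iff₀ (by positivity)] at hh
    linarith
  have hφq : 0 < φ q := by
    by_contra hcon
    have h1 := hgap q hqM (not_lt.1 hcon)
    have h2 : dist y q ≤ dist y z + dist z q := dist_triangle _ _ _
    have h3 : Metric.infDist z M ≤ Metric.infDist y M + dist z y :=
      Metric.infDist_le_infDist_add_dist
    have h4 : dist z y = h * ‖y - p‖ := by rw [dist_eq_norm, hzy, hn]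
    rw [dist_comm y z] at h2
    linarith
  have hyqpos : 0 < ‖y - q‖ := norm_pos_iff.2 (sub_ne_zero.2 (fun h => hy (h ▸ hqM)))
  have hcs : inner ℝ (z - q) (y - q) ≤ ‖z - q‖ * ‖y - q‖ := real_inner_le_norm _ _
  have hexp : inner ℝ (z - q) (y - q) = ‖y - q‖ * ‖y - q‖ + h * inner ℝ (y - p) (y - q) := by
    rw [show z - q = (y - q) + h • (y - p) by rw [hz]; abel, inner_add_left, inner_smul_left,
      real_inner_self_eq_norm_mul_norm]
    simp
  simp only [hφ] at hφq
  rw [dist_eq_norm] at hyq ⊢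
  have hmain : (‖y - q‖ + (1 - η) * (h * ‖y - p‖)) * ‖y - q‖ < ‖z - q‖ * ‖y - q‖ := by
    nlinarith [mul_pos hh0 hφq]
  have := lt_of_mul_lt_mul_right hmain hyqpos.le
  linarith

/-- From a point at distance at most `ρ` from `M`, one can reach the level `ρ` of the distance
function along an almost shortest way if the metric projection is unique below that level. -/
theorem exists_infDist_eq_of_unique_projection [ProperSpace E] {M : Set E} (hM : IsCompact M)
    (hMne : M.Nonempty) {ρ : ℝ}
    (huniq : ∀ y, 0 < Metric.infDist y M → Metric.infDist y M < ρ →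
      ∀ p ∈ M, dist y p = Metric.infDist y M → ∀ q ∈ M, dist y q = Metric.infDist y M → q = p)
    {y : E} (hy0 : 0 < Metric.infDist y M) (hyρ : Metric.infDist y M ≤ ρ)
    {η : ℝ} (hη : 0 < η) (hη1 : η < 1) :
    ∃ z, Metric.infDist z M = ρ ∧ (1 - η) * dist z y ≤ ρ - Metric.infDist y M := by
  have hK : IsCompact {z | Metric.infDist z M ≤ ρ} := by
    have h := hM.cthickening (r := ρ)
    rwa [show Metric.cthickening ρ M = {z | Metric.infDist z M ≤ ρ} from
      Set.ext fun z => mem_cthickening_iff_infDist_le hMne (hy0.le.trans hyρ)] at h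
  -- Penalised maximisation replaces following the gradient flow of the distance: a maximiser
  -- strictly below level `ρ` could be improved by a small step away from its projection.
  obtain ⟨z, hzK, hmax⟩ := hK.exists_isMaxOn ⟨y, hyρ⟩
    (f := fun z => Metric.infDist z M - (1 - η) * dist z y)
    ((Metric.continuous_infDist_pt M).sub
      (continuous_const.mul (continuous_id.dist continuous_const))).continuousOn
  have hzy := hmax (show y ∈ {z | Metric.infDist z M ≤ ρ} from hyρ)
  simp only [Set.mem_ofPred_eq, dist_self, mul_zero, sub_zero] at hzy
  have hzK' : Metric.infDist z M ≤ ρ := hzK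
  have hd : 0 ≤ (1 - η) * dist z y := mul_nonneg (by linarith) dist_nonneg
  have hz0 : 0 < Metric.infDist z M := by linarith
  rcases hzK'.lt_or_eq with hlt | heq
  · exfalso
    obtain ⟨p, hpM, hp⟩ := hM.exists_infDist_eq_dist hMne z
    have hzM : z ∉ M := fun h => by
      rw [Metric.infDist_zero_of_mem h] at hz0; exact lt_irrefl _ hz0
    have hev := eventually_lt_infDist_of_unique_projection hM hMne hzM hpM
      (huniq z hz0 hlt p hpM hp.symm) hη
    have hcont : Continuous fun h : ℝ => Metric.infDist (z + h • (z - p)) M :=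
      (Metric.continuous_infDist_pt M).comp (by fun_prop)
    have hev2 : ∀ᶠ h in 𝓝[>] (0 : ℝ), Metric.infDist (z + h • (z - p)) M < ρ :=
      nhdsWithin_le_nhds (hcont.continuousAt.eventually (Iio_mem_nhds (by simpa using hlt)))
    obtain ⟨h, h1, h2⟩ := (hev.and hev2).exists
    have h3 := hmax (show z + h • (z - p) ∈ {z | Metric.infDist z M ≤ ρ} from h2.le)
    simp only [Set.mem_ofPred_eq] at h3
    have h4 : dist (z + h • (z - p)) y ≤ ‖h • (z - p)‖ + dist z y := by
      calc dist (z + h • (z - p)) y ≤ dist (z + h • (z - p)) z + dist z y := dist_triangle _ _ _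
        _ = _ := by rw [dist_eq_norm, add_sub_cancel_left]
    have h5 := mul_le_mul_of_nonneg_left h4 (by linarith : 0 ≤ 1 - η)
    linarith
  · exact ⟨z, heq, by linarith⟩

/-- The distance from a point `y ∉ M` of the parallel set of `M` to the boundary of this
parallel set, when `M` has larger reach. -/
theorem infDist_frontier_cthickening_le [ProperSpace E] {M : Set E} (hM : IsCompact M)
    (hMne : M.Nonempty) {R ρ : ℝ} (hR : 0 ≤ R) (hRρ : R < ρ)
    (huniq : ∀ y, 0 < Metric.infDist y M → Metric.infDist y M < ρ →
      ∀ p ∈ M, dist y p = Metric.infDist y M → ∀ q ∈ M, dist y q = Metric.infDist y M → q = p)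
    {y : E} (hy0 : 0 < Metric.infDist y M) (hyR : Metric.infDist y M ≤ R) :
    Metric.infDist y (frontier (Metric.cthickening R M)) ≤ R - Metric.infDist y M := by
  -- Aiming at a level `R' > R` puts the endpoint outside the parallel set, so the segment from `y`
  -- crosses the frontier; then `R' → R` and `η → 0`.
  have key : ∀ R' ∈ Set.Ioo R ρ, ∀ η ∈ Set.Ioo (0 : ℝ) 1,
      (1 - η) * Metric.infDist y (frontier (Metric.cthickening R M)) ≤
        R' - Metric.infDist y M := by
    intro R' hR' η hη
    obtain ⟨z, hz, hzy⟩ := exists_infDist_eq_of_unique_projection hM hMne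
      (fun w hw hw' => huniq w hw (hw'.trans hR'.2)) hy0 (hyR.trans hR'.1.le) hη.1 hη.2
    have hyS : y ∈ Metric.cthickening R M :=
      (mem_cthickening_iff_infDist_le hMne hR).2 hyR
    have hzS : z ∉ Metric.cthickening R M := by
      rw [mem_cthickening_iff_infDist_le hMne hR, hz, not_le]
      exact hR'.1
    have hseg : (segment ℝ y z ∩ frontier (Metric.cthickening R M)).Nonempty :=
      (convex_segment y z).isPreconnected.inter_frontier_nonempty
        (left_mem_segment ℝ y z) hyS (right_mem_segment ℝ y z) hzS
    obtain ⟨w, hw, hwf⟩ := hseg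
    have h1 : Metric.infDist y (frontier (Metric.cthickening R M)) ≤ dist y w :=
      Metric.infDist_le_dist_of_mem hwf
    have h2 : dist y w ≤ dist z y := by
      have := (dist_add_dist_of_mem_segment hw)
      rw [dist_comm z y]
      linarith [dist_nonneg (x := w) (y := z)]
    exact (mul_le_mul_of_nonneg_left (h1.trans h2) (by linarith [hη.2])).trans hzy
  set D := Metric.infDist y (frontier (Metric.cthickening R M))
  have step : ∀ η ∈ Set.Ioo (0 : ℝ) 1, (1 - η) * D ≤ R - Metric.infDist y M := by
    intro η hη
    have hlim : Tendsto (fun R' : ℝ => R' - Metric.infDist y M) (𝓝[>] R)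
        (𝓝 (R - Metric.infDist y M)) :=
      ((continuous_id.sub continuous_const).tendsto R).mono_left nhdsWithin_le_nhds
    exact ge_of_tendsto hlim (by
      filter_upwards [Ioo_mem_nhdsGT hRρ] with R' hR' using key R' hR' η hη)
  have hlim : Tendsto (fun η : ℝ => (1 - η) * D) (𝓝[>] 0) (𝓝 ((1 - 0) * D)) :=
    (((continuous_const.sub continuous_id).mul continuous_const).tendsto 0).mono_left
      nhdsWithin_le_nhds
  rw [sub_zero, one_mul] at hlim
  exact le_of_tendsto hlim (by
    filter_upwards [Ioo_mem_nhdsGT one_pos] with η hη using step η hη)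

end Geometry

/-! ### Deterministic error bounds for one denoised point. -/

section Denoising

variable {E : Type*} [NormedAddCommGroup E] [InnerProductSpace ℝ E]

/-- A point `v` outside the ball `B(0, R)` which is almost as close to `t • u` as `R • u` is lies
close to `R • u`. -/
theorem mul_sq_norm_sub_le_of_almost_nearest {u v : E} (hu : ‖u‖ = 1) {t R a : ℝ} (ht : 0 ≤ t)
    (htR : t ≤ R) (hv : R ≤ ‖v‖) (hvt : ‖v - t • u‖ ≤ R - t + 2 * a) :
    t * ‖v - R • u‖ ^ 2 ≤ 4 * a * R * (R - t + a) := by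
  have hR : 0 ≤ R := ht.trans htR
  have h1 : ∀ s : ℝ, ‖v - s • u‖ ^ 2 = ‖v‖ ^ 2 - 2 * s * inner ℝ v u + s ^ 2 := by
    intro s
    rw [norm_sub_sq_real, norm_smul, hu, inner_smul_right, mul_one, Real.norm_eq_abs, sq_abs]
    ring
  have h2 : ‖v - t • u‖ ^ 2 ≤ (R - t + 2 * a) ^ 2 := pow_le_pow_left₀ (norm_nonneg _) hvt 2
  have h3 : R ^ 2 ≤ ‖v‖ ^ 2 := pow_le_pow_left₀ hR hv 2
  rw [h1] at h2 ⊢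
  -- The inner product disappears from `t‖v - R u‖² = R‖v - t u‖² - (R - t)‖v‖² + t R (R - t)`.
  nlinarith [mul_le_mul_of_nonneg_left h2 hR, mul_le_mul_of_nonneg_left h3 (sub_nonneg.2 htR)]

theorem norm_add_div_smul_sub_sub (x y : E) (hxy : x ≠ y) (s : ℝ) :
    ‖x + (s / ‖y - x‖) • (y - x) - y‖ = |s - ‖y - x‖| := by
  have hn : ‖y - x‖ ≠ 0 := norm_ne_zero_iff.2 (sub_ne_zero.2 hxy.symm)
  have : x + (s / ‖y - x‖) • (y - x) - y = ((s - ‖y - x‖) / ‖y - x‖) • (y - x) := by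
    rw [sub_div, div_self hn, sub_smul, one_smul]
    abel
  rw [this, norm_smul, Real.norm_eq_abs, abs_div, abs_of_nonneg (norm_nonneg (y - x)),
    div_mul_cancel₀ _ hn]

/-- Stability of the map which moves a point `y` to the point at distance `R` from `x` in the
direction of `y`, around a configuration where `y = x - s • u`. -/
theorem norm_add_div_smul_sub_le {x q y u : E} (hu : ‖u‖ = 1) {s R R' lam δ e : ℝ} (hs : 0 ≤ s)
    (hy : y = q - s • u) (hx : ‖x - q‖ ≤ δ) (hR : |R' - R| ≤ e) (hlam : 0 < lam) (hR' : 0 < R')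
    (hfar : lam * R' < ‖y - x‖) :
    ‖x + (R' / ‖y - x‖) • (y - x) - (q - R • u)‖ ≤ δ * (1 + 2 / lam) + e := by
  set w := y - x with hw
  have hwpos : 0 < ‖w‖ := (mul_pos hlam hR').trans hfar
  have h1 : w + s • u = q - x := by rw [hw, hy]; abel
  have h2 : |‖w‖ - s| ≤ δ := by
    have := abs_norm_sub_norm_le w (-(s • u))
    rw [sub_neg_eq_add, h1, norm_neg, norm_smul, hu, mul_one, Real.norm_of_nonneg hs,
      norm_sub_rev q x] at this
    exact this.trans hx
  have h3 : ‖w + ‖w‖ • u‖ ≤ 2 * δ := by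
    calc ‖w + ‖w‖ • u‖ = ‖(q - x) + (‖w‖ - s) • u‖ := by rw [← h1, sub_smul]; congr 1; abel
      _ ≤ ‖q - x‖ + ‖(‖w‖ - s) • u‖ := norm_add_le _ _
      _ ≤ δ + δ := by
        rw [norm_smul, hu, mul_one, norm_sub_rev]
        exact add_le_add hx h2
      _ = 2 * δ := by ring
  have hδ : 0 ≤ δ := (norm_nonneg _).trans hx
  have hdec : x + (R' / ‖w‖) • w - (q - R • u)
      = (x - q) + (R' / ‖w‖) • (w + ‖w‖ • u) + (R - R') • u := by
    rw [smul_add, smul_smul, div_mul_cancel₀ _ hwpos.ne', sub_smul]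
    abel
  -- The directional error `w + ‖w‖ u` is amplified by `R' / ‖w‖`, which the trimming condition
  -- keeps below `1 / lam`.
  have h4 : ‖(R' / ‖w‖) • (w + ‖w‖ • u)‖ ≤ 1 / lam * (2 * δ) := by
    rw [norm_smul, Real.norm_of_nonneg (by positivity)]
    refine mul_le_mul ?_ h3 (norm_nonneg _) (by positivity)
    rw [div_le_div_iff₀ hwpos hlam]
    linarith
  have h5 : ‖(R - R') • u‖ ≤ e := by
    rw [norm_smul, hu, mul_one, Real.norm_eq_abs, abs_sub_comm]
    exact hR
  rw [hdec]
  calc _ ≤ ‖x - q‖ + ‖(R' / ‖w‖) • (w + ‖w‖ • u)‖ + ‖(R - R') • u‖ := norm_add₃_le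
    _ ≤ δ + 1 / lam * (2 * δ) + e := add_le_add (add_le_add hx h4) h5
    _ = _ := by ring

/-- The denoised point obtained from `y` is close to the metric projection `p` of `y`: here `x` is
the projection of `y` on the estimated boundary, and `q` a boundary point close to `x`. -/
theorem norm_denoised_sub_le {x y p q : E} {R R' lam a b e : ℝ}
    (hy0 : 0 < ‖y - p‖) (hyR : ‖y - p‖ ≤ R) (hqp : R ≤ ‖q - p‖)
    (hyq : dist y q ≤ R - ‖y - p‖ + 2 * a) (hxq : dist x q ≤ a) (hb : 0 < b) (hb1 : b ≤ 1)
    (ha0 : 0 ≤ a) (hab : a ≤ b ^ 3) (hR : |R' - R| ≤ e) (hlam : 0 < lam) (hR' : 0 < R')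
    (hfar : lam * R' < ‖y - x‖) :
    ‖x + (R' / ‖y - x‖) • (y - x) - p‖ ≤ ((2 * R + 3) * (1 + 2 / lam) + 5) * b + e := by
  set t := ‖y - p‖ with ht
  have hRpos : 0 < R := hy0.trans_le hyR
  have hb2 : b ^ 2 ≤ 1 := pow_le_one₀ hb.le hb1
  have hab1 : a ≤ b := hab.trans (by nlinarith)
  have ha1 : a ≤ 1 := hab1.trans hb1
  have hC : 0 ≤ (2 * R + 3) * (1 + 2 / lam) := by positivity
  -- The direction of `y - p` is unstable when `t` is small, but then `y` is itself a good
  -- approximation of `p`. For `t > b`, dividing `O(a) = O(b ^ 3)` by `t` leaves a squared error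
  -- `O(b ^ 2)`; this balance yields the cube root of `a`.
  rcases le_or_gt t b with htb | htb
  · have hyx : x ≠ y := by
      rintro rfl
      rw [sub_self, norm_zero] at hfar
      exact absurd (mul_pos hlam hR') (not_lt.2 hfar.le)
    have h1 := norm_add_div_smul_sub_sub x y hyx R'
    have h2 : ‖y - x‖ ≤ R - t + 3 * a := by
      rw [← dist_eq_norm]
      linarith [dist_triangle_right y x q]
    have h3 : R - t - a ≤ ‖y - x‖ := by
      rw [← dist_eq_norm]
      rw [← dist_eq_norm] at hqp ht
      have := dist_triangle4 q x y p
      rw [dist_comm q x, dist_comm x y] at this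
      linarith
    have h4 : |R' - ‖y - x‖| ≤ e + t + 3 * a := by
      rw [abs_le] at hR ⊢
      constructor <;> linarith [hR.1, hR.2]
    calc ‖x + (R' / ‖y - x‖) • (y - x) - p‖
        ≤ ‖x + (R' / ‖y - x‖) • (y - x) - y‖ + ‖y - p‖ := norm_sub_le_norm_sub_add_norm_sub _ _ _
      _ ≤ e + t + 3 * a + t := by rw [h1, ← ht]; linarith
      _ ≤ _ := by nlinarith
  · set u := t⁻¹ • (y - p) with hu
    have hun : ‖u‖ = 1 := by
      rw [hu, norm_smul, norm_inv, Real.norm_of_nonneg hy0.le, ← ht, inv_mul_cancel₀ hy0.ne']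
    have htu : t • u = y - p := by rw [hu, smul_smul, mul_inv_cancel₀ hy0.ne', one_smul]
    have h1 := mul_sq_norm_sub_le_of_almost_nearest hun hy0.le hyR hqp (by
      rw [htu, show q - p - (y - p) = q - y by abel, ← dist_eq_norm, dist_comm]
      exact hyq)
    have h2 : ‖q - p - R • u‖ ≤ 2 * (R + 1) * b := by
      refine (sq_le_sq₀ (norm_nonneg _) (by positivity)).1 ?_
      have h3 : b * ‖q - p - R • u‖ ^ 2 ≤ b * (2 * (R + 1) * b) ^ 2 := by
        calc b * ‖q - p - R • u‖ ^ 2 ≤ t * ‖q - p - R • u‖ ^ 2 := by gcongr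
          _ ≤ 4 * a * R * (R - t + a) := h1
          _ ≤ 4 * b ^ 3 * R * (R + 1) := by
            have : 0 ≤ R - t + a := by linarith
            gcongr
            linarith
          _ ≤ 4 * b ^ 3 * (R + 1) * (R + 1) := by gcongr; linarith
          _ = _ := by ring
      exact le_of_mul_le_mul_left h3 hb
    have h4 : ‖x - (p + R • u)‖ ≤ (2 * R + 3) * b := by
      calc ‖x - (p + R • u)‖ ≤ ‖x - q‖ + ‖q - (p + R • u)‖ := 
          norm_sub_le_norm_sub_add_norm_sub _ _ _
        _ ≤ b + 2 * (R + 1) * b := by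
          refine add_le_add ?_ ?_
          · rw [← dist_eq_norm]; exact hxq.trans hab1
          · rwa [← sub_sub]
        _ = _ := by ring
    have h5 := norm_add_div_smul_sub_le (x := x) (q := p + R • u) (y := y) (s := R - t) (R := R)
      hun (by linarith) (by rw [sub_smul, htu]; abel) h4 hR hlam hR' hfar
    rw [add_sub_cancel_right] at h5
    calc _ ≤ _ := h5
      _ ≤ _ := by nlinarith

theorem le_infDist_of_mem_frontier_cthickening {X : Type*} [PseudoMetricSpace X] {M : Set X}
    {R : ℝ} (hR : 0 ≤ R) {q : X}
    (hq : q ∈ frontier (Metric.cthickening R M)) : R ≤ Metric.infDist q M := by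
  have h := Metric.frontier_cthickening_subset M hq
  rw [Set.mem_ofPred_eq] at h
  rw [Metric.infDist, h, ENNReal.toReal_ofReal hR]

/-- Deterministic bounds for the denoising of one point `y` of the parallel set of `M`. -/
theorem exists_norm_denoised_sub_le [ProperSpace E] {M : Set E} (hM : IsCompact M)
    (hMne : M.Nonempty) {R ρ : ℝ} (hR : 0 < R) (hRρ : R < ρ)
    (huniq : ∀ y, 0 < Metric.infDist y M → Metric.infDist y M < ρ →
      ∀ p ∈ M, dist y p = Metric.infDist y M → ∀ q ∈ M, dist y q = Metric.infDist y M → q = p)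
    {D : Set E} (hfne : (frontier (Metric.cthickening R M)).Nonempty) {a : ℝ} (ha : 0 < a)
    (hD : Metric.hausdorffEDist D (frontier (Metric.cthickening R M)) < ENNReal.ofReal a)
    {x y : E} (hxD : x ∈ D) (hx : ∀ q ∈ D, dist y x ≤ dist y q)
    (hy0 : 0 < Metric.infDist y M) (hyR : Metric.infDist y M ≤ R) :
    R - Metric.infDist y M - a ≤ dist y x ∧ dist y x ≤ R - Metric.infDist y M + a ∧
    ∀ {R' lam b e : ℝ}, 0 < b → b ≤ 1 → a ≤ b ^ 3 → |R' - R| ≤ e → 0 < lam → 0 < R' →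
      lam * R' < ‖y - x‖ → ∃ p ∈ M,
        ‖x + (R' / ‖y - x‖) • (y - x) - p‖ ≤ ((2 * R + 3) * (1 + 2 / lam) + 5) * b + e := by
  obtain ⟨p, hpM, hp⟩ := hM.exists_infDist_eq_dist hMne y
  -- Both directions of the Hausdorff bound are used: `q` is the true boundary point near `x`, while
  -- `x₀`, near the true nearest boundary point `q₀`, bounds `dist y x` from above by minimality of
  -- `x`.
  obtain ⟨q, hqF, hxq⟩ := Metric.exists_edist_lt_of_hausdorffEDist_lt hxD hD
  rw [edist_dist, ENNReal.ofReal_lt_ofReal_iff ha] at hxq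
  obtain ⟨q₀, hq₀F, hq₀⟩ := isClosed_frontier.exists_infDist_eq_dist hfne y
  rw [Metric.hausdorffEDist_comm] at hD
  obtain ⟨x₀, hx₀D, hx₀⟩ := Metric.exists_edist_lt_of_hausdorffEDist_lt hq₀F hD
  rw [edist_dist, ENNReal.ofReal_lt_ofReal_iff ha] at hx₀
  have hF := infDist_frontier_cthickening_le hM hMne hR.le hRρ huniq hy0 hyR
  have hyx : dist y x ≤ R - Metric.infDist y M + a := by
    linarith [hx x₀ hx₀D, dist_triangle y q₀ x₀]
  have hqM := le_infDist_of_mem_frontier_cthickening hR.le hqF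
  have hyx' : R - Metric.infDist y M - a ≤ dist y x := by
    have h1 : Metric.infDist q M ≤ Metric.infDist y M + dist q y :=
      Metric.infDist_le_infDist_add_dist
    linarith [dist_triangle q x y, dist_comm q x, dist_comm x y]
  refine ⟨hyx', hyx, fun hb hb1 hab hRe hlam hR' hfar => ⟨p, hpM, ?_⟩⟩
  rw [hp] at hyx
  rw [hp, dist_eq_norm] at hy0 hyR
  refine norm_denoised_sub_le hy0 hyR ?_ ?_ hxq.le hb hb1 ha.le hab hRe hlam hR' hfar
  · rw [← dist_eq_norm]
    exact hqM.trans (Metric.infDist_le_dist_of_mem hpM)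
  · rw [← dist_eq_norm]
    linarith [dist_triangle y x q]

end Denoising

/-! ### Packing bounds and the almost sure covering rate of the sample. -/

section Covering

theorem unitBallVolume_pos (k : ℕ) : 0 < unitBallVolume k :=
  ENNReal.toReal_pos (Metric.measure_closedBall_pos _ _ one_pos).ne' measure_closedBall_lt_top.ne

theorem volume_real_closedBall {d : ℕ} (x : EuclideanSpace ℝ (Fin d)) {ε : ℝ} (hε : 0 ≤ ε) :
    volume.real (Metric.closedBall x ε) = ε ^ d * unitBallVolume d := by
  rw [Measure.addHaar_real_closedBall' volume x hε, finrank_euclideanSpace_fin, unitBallVolume]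

theorem measure_cthickening_ne_top {d : ℕ} {A : Set (EuclideanSpace ℝ (Fin d))}
    (hA : Bornology.IsBounded A) (δ : ℝ) : volume (Metric.cthickening δ A) ≠ ⊤ :=
  hA.cthickening.measure_lt_top.ne

/-- Volume bound for the cardinality of a separated set. -/
theorem card_mul_le_of_pairwise_lt_dist {d : ℕ} {M : Set (EuclideanSpace ℝ (Fin d))}
    (hM : Bornology.IsBounded M) {ε : ℝ} (hε : 0 < ε) {T : Finset (EuclideanSpace ℝ (Fin d))}
    (hTM : (T : Set (EuclideanSpace ℝ (Fin d))) ⊆ M)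
    (hT : (T : Set (EuclideanSpace ℝ (Fin d))).Pairwise fun x y => ε < dist x y) :
    (T.card : ℝ) * ((ε / 2) ^ d * unitBallVolume d)
      ≤ volume.real (Metric.cthickening (ε / 2) M) := by
  have hdisj : (T : Set (EuclideanSpace ℝ (Fin d))).PairwiseDisjoint
      fun x => Metric.closedBall x (ε / 2) := fun x hx y hy hxy =>
    Metric.closedBall_disjoint_closedBall (by linarith [hT hx hy hxy])
  have h := measureReal_biUnion_finset (μ := volume) hdisj
    (fun x _ => Metric.isClosed_closedBall.measurableSet)
    (fun x _ => measure_closedBall_lt_top.ne)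
  rw [Finset.sum_congr rfl (fun x _ => volume_real_closedBall x (by positivity)),
    Finset.sum_const, nsmul_eq_mul] at h
  rw [← h]
  refine measureReal_mono ?_ (measure_cthickening_ne_top hM _)
  exact Set.iUnion₂_subset fun x hx => Metric.closedBall_subset_cthickening (hTM hx) _

/-- A separated subset of largest cardinality is a net, since an uncovered point could be added to
it; the packing bound ensures that a largest one exists. -/
theorem exists_finset_cover_card_mul_le {d : ℕ} {M : Set (EuclideanSpace ℝ (Fin d))}
    (hM : Bornology.IsBounded M) {ε : ℝ} (hε : 0 < ε) :
    ∃ T : Finset (EuclideanSpace ℝ (Fin d)), (T : Set (EuclideanSpace ℝ (Fin d))) ⊆ M ∧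
      (∀ x ∈ M, ∃ y ∈ T, dist x y ≤ ε) ∧
      (T.card : ℝ) * ((ε / 2) ^ d * unitBallVolume d)
        ≤ volume.real (Metric.cthickening (ε / 2) M) := by
  classical
  set s : Set ℕ := {k | ∃ T : Finset (EuclideanSpace ℝ (Fin d)), T.card = k ∧
    (T : Set (EuclideanSpace ℝ (Fin d))) ⊆ M ∧
    (T : Set (EuclideanSpace ℝ (Fin d))).Pairwise fun x y => ε < dist x y} with hs
  have hpos : 0 < (ε / 2) ^ d * unitBallVolume d :=
    mul_pos (by positivity) (unitBallVolume_pos d)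
  have hbdd : BddAbove s := by
    refine ⟨⌈volume.real (Metric.cthickening (ε / 2) M) / ((ε / 2) ^ d * unitBallVolume d)⌉₊, ?_⟩
    rintro k ⟨T, rfl, hTM, hT⟩
    have h := card_mul_le_of_pairwise_lt_dist hM hε hTM hT
    rw [← le_div_iff₀ hpos] at h
    exact_mod_cast h.trans (Nat.le_ceil _)
  obtain ⟨T, hTk, hTM, hT⟩ := Nat.sSup_mem (s := s) ⟨0, ∅, by simp⟩ hbdd
  refine ⟨T, hTM, fun x hx => ?_, card_mul_le_of_pairwise_lt_dist hM hε hTM hT⟩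
  by_contra! hcon
  have hxT : x ∉ T := fun h => by
    have := hcon x h
    rw [dist_self] at this
    linarith
  have hmem : (insert x T).card ∈ s := by
    refine ⟨insert x T, rfl, ?_, ?_⟩
    · rw [Finset.coe_insert]
      exact Set.insert_subset hx hTM
    · rw [Finset.coe_insert]
      refine hT.insert fun y hy _ => ⟨hcon y hy, ?_⟩
      rw [dist_comm]
      exact hcon y hy
  have := le_csSup hbdd hmem
  rw [Finset.card_insert_of_notMem hxT, ← hTk] at this
  omega

/-- Probability that none of `n` independent points falls in a set of probability at least `p`. -/
theorem measure_forall_notMem_le {Ω E : Type*} [MeasurableSpace Ω] [MeasurableSpace E]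
    {P : Measure Ω} [IsProbabilityMeasure P] {Y : ℕ → Ω → E} (hY : ∀ i, Measurable (Y i))
    (hindep : iIndepFun Y P) {B : Set E} (hB : MeasurableSet B) {p : ℝ}
    (hp : ∀ i, ENNReal.ofReal p ≤ P (Y i ⁻¹' B)) (n : ℕ) :
    P {ω | ∀ i < n, Y i ω ∉ B} ≤ ENNReal.ofReal (Real.exp (-(n * p))) := by
  have h1 : {ω | ∀ i < n, Y i ω ∉ B} = ⋂ i ∈ Finset.range n, Y i ⁻¹' Bᶜ := by
    ext ω
    simp
  rw [h1, hindep.measure_inter_preimage_eq_mul (Finset.range n) (sets := fun _ => Bᶜ)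
    (fun _ _ => hB.compl)]
  calc ∏ i ∈ Finset.range n, P (Y i ⁻¹' Bᶜ)
      ≤ ∏ i ∈ Finset.range n, ENNReal.ofReal (Real.exp (-p)) := by
        refine Finset.prod_le_prod' fun i _ => ?_
        rw [Set.preimage_compl, prob_compl_eq_one_sub (hY i hB)]
        calc 1 - P (Y i ⁻¹' B) ≤ 1 - ENNReal.ofReal p := tsub_le_tsub_left (hp i) _
          _ ≤ ENNReal.ofReal (1 - p) := by
            rw [tsub_le_iff_right, ← ENNReal.ofReal_one]
            calc ENNReal.ofReal 1 = ENNReal.ofReal (1 - p + p) := by rw [sub_add_cancel]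
              _ ≤ _ := ENNReal.ofReal_add_le
          _ ≤ _ := ENNReal.ofReal_le_ofReal (by linarith [Real.add_one_le_exp (-p)])
    _ = _ := by
      rw [Finset.prod_const, Finset.card_range, ← ENNReal.ofReal_pow (Real.exp_pos _).le,
        ← Real.exp_nat_mul, mul_neg]

/-- The points of a bounded set are approximated at rate `(log n / n) ^ (1 / d)` by a sample whose
law gives mass at least `κ ε ^ d` to the balls of radius `ε` centred in the set. -/
theorem ae_eventually_forall_exists_dist_le {d : ℕ} (hd : 0 < d)
    {M : Set (EuclideanSpace ℝ (Fin d))} (hM : Bornology.IsBounded M)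
    {Ω : Type*} [MeasurableSpace Ω] {P : Measure Ω} [IsProbabilityMeasure P]
    {Y : ℕ → Ω → EuclideanSpace ℝ (Fin d)} (hY : ∀ i, Measurable (Y i)) (hindep : iIndepFun Y P)
    {κ ε₀ : ℝ} (hε₀ : 0 < ε₀)
    (hball : ∀ x ∈ M, ∀ ε, 0 < ε → ε ≤ ε₀ → ∀ i,
      ENNReal.ofReal (κ * ε ^ d) ≤ P (Y i ⁻¹' Metric.closedBall x ε))
    {c : ℝ} (hc : 0 < c) (hκc : 3 ≤ κ * c ^ d) :
    ∀ᵐ ω ∂P, ∀ᶠ n : ℕ in atTop, ∀ x ∈ M, ∃ i < n,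
      dist (Y i ω) x ≤ 2 * (c * (Real.log n / n) ^ (1 / (d : ℝ))) := by
  set ε : ℕ → ℝ := fun n => c * (Real.log n / n) ^ (1 / (d : ℝ)) with hεdef
  have hdR : (0 : ℝ) < d := by exact_mod_cast hd
  have hlog : Tendsto (fun n : ℕ => Real.log n / n) atTop (𝓝 0) := by
    have := Real.isLittleO_log_id_atTop.tendsto_div_nhds_zero.comp
      (tendsto_natCast_atTop_atTop (R := ℝ))
    exact this
  have hε0 : Tendsto ε atTop (𝓝 0) := by
    have h := (hlog.rpow_const (p := 1 / (d : ℝ)) (Or.inr (by positivity))).const_mul c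
    rwa [Real.zero_rpow (by positivity), mul_zero] at h
  have hlog1 : ∀ᶠ n : ℕ in atTop, 1 ≤ Real.log n :=
    (Real.tendsto_log_atTop.comp tendsto_natCast_atTop_atTop).eventually_ge_atTop 1
  set V := volume.real (Metric.cthickening 1 M)
  -- A net at scale `ε n` has at most `V 2^d / (ω_d ε_n^d)` points, hence at most `C n` once `log n
  -- ≥ 1`.
  set C := V * 2 ^ d / (c ^ d * unitBallVolume d) with hC
  have hω := unitBallVolume_pos d
  have hCnn : 0 ≤ C := by positivity
  -- The radius `2 ε n` spends one `ε n` on the net and one on the ball around a net point. Each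
  -- such ball is missed with probability at most `n⁻³`, so the union bound over `C n` points is
  -- summable.
  set bad : ℕ → Set Ω := fun n => {ω | ¬ ∀ x ∈ M, ∃ i < n, dist (Y i ω) x ≤ 2 * ε n} with hbad
  have hbound : ∀ᶠ n : ℕ in atTop, P (bad n) ≤ ENNReal.ofReal (C * (1 / (n : ℝ) ^ 2)) := by
    filter_upwards [hlog1, eventually_gt_atTop 0, hε0.eventually (Iic_mem_nhds hε₀),
      hε0.eventually (Iic_mem_nhds one_pos)] with n hn hn0 hnε hnε1
    have hnR : (0 : ℝ) < n := by exact_mod_cast hn0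
    have hq : 0 < Real.log n / n := div_pos (by linarith) hnR
    have hεpos : 0 < ε n := mul_pos hc (Real.rpow_pos_of_pos hq _)
    have hεd : ε n ^ d = c ^ d * (Real.log n / n) := by
      simp only [hεdef]
      rw [mul_pow, ← Real.rpow_natCast ((Real.log n / n) ^ (1 / (d : ℝ))), ← Real.rpow_mul hq.le,
        one_div_mul_cancel hdR.ne', Real.rpow_one]
    obtain ⟨T, hTM, hTcov, hTcard⟩ := exists_finset_cover_card_mul_le hM hεpos
    have hsub : bad n ⊆ ⋃ y ∈ T, {ω | ∀ i < n, Y i ω ∉ Metric.closedBall y (ε n)} := by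
      intro ω hω'
      simp only [hbad, Set.mem_ofPred_eq] at hω'
      push Not at hω'
      obtain ⟨x, hx, hfar⟩ := hω'
      obtain ⟨y, hyT, hxy⟩ := hTcov x hx
      refine Set.mem_iUnion₂.2 ⟨y, hyT, fun i hi hmem => ?_⟩
      rw [Metric.mem_closedBall] at hmem
      have := hfar i hi
      linarith [dist_triangle_right (Y i ω) x y]
    have hone : ∀ y ∈ T, P {ω | ∀ i < n, Y i ω ∉ Metric.closedBall y (ε n)}
        ≤ ENNReal.ofReal (1 / (n : ℝ) ^ 3) := by
      intro y hy
      refine (measure_forall_notMem_le hY hindep Metric.isClosed_closedBall.measurableSet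
        (hball y (hTM hy) (ε n) hεpos hnε) n).trans (ENNReal.ofReal_le_ofReal ?_)
      have h1 : (n : ℝ) * (κ * ε n ^ d) = κ * c ^ d * Real.log n := by
        rw [hεd]
        field_simp
      rw [h1, Real.exp_neg, one_div]
      refine inv_anti₀ (by positivity) ?_
      rw [← Real.log_le_iff_le_exp (by positivity), Real.log_pow]
      push_cast
      exact mul_le_mul_of_nonneg_right hκc (by linarith)
    have hcard : (T.card : ℝ) ≤ C * n := by
      have h1 : volume.real (Metric.cthickening (ε n / 2) M) ≤ V :=
        measureReal_mono (Metric.cthickening_mono (by linarith) _)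
          (measure_cthickening_ne_top hM _)
      have h2 := hTcard.trans h1
      rw [div_pow, hεd] at h2
      rw [hC, div_mul_eq_mul_div, le_div_iff₀ (by positivity)]
      have h3 : (T.card : ℝ) * (c ^ d * unitBallVolume d) * Real.log n ≤ V * 2 ^ d * n := by
        have h4 := mul_le_mul_of_nonneg_right h2 (by positivity : (0 : ℝ) ≤ 2 ^ d * n)
        have h5 : (T.card : ℝ) * (c ^ d * (Real.log n / n) / 2 ^ d * unitBallVolume d) *
          (2 ^ d * n) = (T.card : ℝ) * (c ^ d * unitBallVolume d) * Real.log n := by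
          field_simp
        rw [h5] at h4
        linarith
      exact (le_mul_of_one_le_right (by positivity) hn).trans h3
    calc P (bad n) ≤ ∑ y ∈ T, P {ω | ∀ i < n, Y i ω ∉ Metric.closedBall y (ε n)} :=
          (measure_mono hsub).trans (measure_biUnion_finset_le _ _)
      _ ≤ ∑ y ∈ T, ENNReal.ofReal (1 / (n : ℝ) ^ 3) := Finset.sum_le_sum hone
      _ = ENNReal.ofReal (T.card * (1 / (n : ℝ) ^ 3)) := by
        rw [Finset.sum_const, nsmul_eq_mul, ENNReal.ofReal_mul (by positivity),
          ENNReal.ofReal_natCast]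
      _ ≤ _ := by
        refine ENNReal.ofReal_le_ofReal ?_
        calc (T.card : ℝ) * (1 / (n : ℝ) ^ 3) ≤ C * n * (1 / (n : ℝ) ^ 3) := by gcongr
          _ = _ := by field_simp
  obtain ⟨N, hN⟩ := eventually_atTop.1 hbound
  have hsum : ∑' n, P (bad (n + N)) ≠ ⊤ := by
    have hs : Summable fun n : ℕ => C * (1 / ((n + N : ℕ) : ℝ) ^ 2) :=
      ((summable_nat_add_iff N).2 (Real.summable_one_div_nat_pow.2 one_lt_two)).mul_left C
    refine ne_top_of_le_ne_top hs.tsum_ofReal_ne_top (ENNReal.tsum_le_tsum fun n => ?_)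
    exact hN (n + N) (Nat.le_add_left _ _)
  filter_upwards [ae_eventually_notMem hsum] with ω hω
  have h := (tendsto_sub_atTop_nat N).eventually hω
  filter_upwards [h, eventually_ge_atTop N] with n hn hNn
  rw [Nat.sub_add_cancel hNn] at hn
  exact not_not.1 hn

end Covering

/-! ### Stability of the Minkowski content and two-sided approximation of `M` by the denoised
sample. -/

section Consistency

variable {d : ℕ}

/-- The reach bounds the local reach at `p` from below, so some ball around `p` inside `unp M`
contains `y`. -/
theorem eq_of_isMetricProjection_of_lt_reach {M : Set (EuclideanSpace ℝ (Fin d))}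
    {y p q : EuclideanSpace ℝ (Fin d)} (hy : ENNReal.ofReal (Metric.infDist y M) < reach M)
    (hpM : p ∈ M) (hp : dist y p = Metric.infDist y M)
    (hqM : q ∈ M) (hq : dist y q = Metric.infDist y M) : q = p := by
  have h1 : ENNReal.ofReal (Metric.infDist y M) < localReach M p :=
    hy.trans_le (iInf₂_le p hpM)
  simp only [localReach, lt_iSup_iff] at h1
  obtain ⟨s, hs, hball, hlt⟩ := h1
  rw [ENNReal.ofReal_lt_ofReal_iff hs, ← hp] at hlt
  have hproj : ∀ w ∈ M, dist y w = Metric.infDist y M → IsMetricProjection M y w :=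
    fun w hw h => ⟨hw, fun v hv => h ▸ Metric.infDist_le_dist_of_mem hv⟩
  exact (hball (Metric.mem_ball.2 hlt)).unique (hproj q hqM hq) (hproj p hpM hp)

theorem offsetRatio_mul_eq {d' : ℕ} (A : Set (EuclideanSpace ℝ (Fin d))) {ρ : ℝ} (hρ : 0 < ρ) :
    offsetRatio d' A ρ * (unitBallVolume (d - d') * ρ ^ (d - d'))
      = volume.real (Metric.cthickening ρ A) :=
  div_mul_cancel₀ _ (mul_pos (unitBallVolume_pos _) (by positivity)).ne'

/-- A bounded set with finite Minkowski content of dimension less than `d` is negligible. -/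
theorem measure_eq_zero_of_hasMinkowskiContent {d' : ℕ} (hd : d' < d)
    {M : Set (EuclideanSpace ℝ (Fin d))} (hM : Bornology.IsBounded M) {L : ℝ}
    (hL : HasMinkowskiContent d' M L) : volume M = 0 := by
  have hk : d - d' ≠ 0 := by omega
  have h0 : Tendsto (fun ρ : ℝ => unitBallVolume (d - d') * ρ ^ (d - d')) (𝓝[>] 0) (𝓝 0) := by
    have : Tendsto (fun ρ : ℝ => unitBallVolume (d - d') * ρ ^ (d - d')) (𝓝 0)
        (𝓝 (unitBallVolume (d - d') * 0 ^ (d - d'))) :=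
      (continuous_const.mul (continuous_pow _)).tendsto 0
    rw [zero_pow hk, mul_zero] at this
    exact this.mono_left nhdsWithin_le_nhds
  have h1 := Tendsto.mul hL h0
  rw [mul_zero] at h1
  have h2 : volume.real M ≤ 0 := ge_of_tendsto h1 (by
    filter_upwards [self_mem_nhdsWithin] with ρ hρ
    rw [offsetRatio_mul_eq M hρ]
    exact measureReal_mono (Metric.self_subset_cthickening M) (measure_cthickening_ne_top hM _))
  exact (measureReal_eq_zero_iff hM.measure_lt_top.ne).1 (h2.antisymm measureReal_nonneg)

/-- Sets whose Hausdorff distance to `M` is negligible with respect to the radii have the same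
limiting normalised volumes as `M`. -/
theorem tendsto_offsetRatio_of_subset_cthickening {d' : ℕ}
    {M : Set (EuclideanSpace ℝ (Fin d))} (hM : Bornology.IsBounded M) {L : ℝ}
    (hL : HasMinkowskiContent d' M L) {Z : ℕ → Set (EuclideanSpace ℝ (Fin d))} {r δ : ℕ → ℝ}
    (hrpos : ∀ᶠ n in atTop, 0 < r n) (hr : Tendsto r atTop (𝓝 0)) (hδ : δ =o[atTop] r)
    (hδ0 : ∀ᶠ n in atTop, 0 ≤ δ n)
    (hZM : ∀ᶠ n in atTop, Z n ⊆ Metric.cthickening (δ n) M)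
    (hMZ : ∀ᶠ n in atTop, M ⊆ Metric.cthickening (δ n) (Z n)) :
    Tendsto (fun n => offsetRatio d' (Z n) (r n)) atTop (𝓝 L) := by
  have hδr : Tendsto (fun n => δ n / r n) atTop (𝓝 0) := hδ.tendsto_div_nhds_zero
  have hδlim : Tendsto δ atTop (𝓝 0) := hδ.isBigO.trans_tendsto hr
  have hlt : ∀ᶠ n in atTop, δ n < r n := by
    filter_upwards [hrpos, hδr.eventually (Iio_mem_nhds one_pos)] with n hn h
    exact (div_lt_one hn).1 h
  -- Normalising by `r` instead of `s` costs the factor `(s / r) ^ (d - d')`, which tends to `1`.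
  have key : ∀ s : ℕ → ℝ, (∀ᶠ n in atTop, 0 < s n) → Tendsto s atTop (𝓝 0) →
      Tendsto (fun n => s n / r n) atTop (𝓝 1) →
      Tendsto (fun n => volume.real (Metric.cthickening (s n) M) /
        (unitBallVolume (d - d') * r n ^ (d - d'))) atTop (𝓝 L) := by
    intro s hs hs0 hsr
    have h1 : Tendsto (fun n => offsetRatio d' M (s n)) atTop (𝓝 L) :=
      hL.comp (tendsto_nhdsWithin_iff.2 ⟨hs0, hs⟩)
    have h2 := h1.mul (hsr.pow (d - d'))
    rw [one_pow, mul_one] at h2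
    refine h2.congr' ?_
    filter_upwards [hs, hrpos] with n hn hrn
    rw [← offsetRatio_mul_eq M hn, div_pow]
    have := (unitBallVolume_pos (d - d')).ne'
    field_simp
  have hlow := key (fun n => r n - δ n) (hlt.mono fun n hn => sub_pos.2 hn)
    (by simpa using hr.sub hδlim) (by
      have h := (tendsto_const_nhds (x := (1 : ℝ))).sub hδr
      rw [sub_zero] at h
      refine h.congr' ?_
      filter_upwards [hrpos] with n hn
      rw [sub_div, div_self hn.ne'])
  have hupp := key (fun n => r n + δ n)
    (by filter_upwards [hrpos, hδ0] with n h1 h2 using add_pos_of_pos_of_nonneg h1 h2)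
    (by simpa using hr.add hδlim) (by
      have h := (tendsto_const_nhds (x := (1 : ℝ))).add hδr
      rw [add_zero] at h
      refine h.congr' ?_
      filter_upwards [hrpos] with n hn
      rw [add_div, div_self hn.ne'])
  refine tendsto_of_tendsto_of_tendsto_of_le_of_le' hlow hupp ?_ ?_
  · filter_upwards [hrpos, hδ0, hlt, hMZ, hZM] with n h1 h2 h3 h4 h5
    have hpos := mul_pos (unitBallVolume_pos (d - d')) (pow_pos h1 (d - d'))
    refine div_le_div_of_nonneg_right ?_ hpos.le
    refine measureReal_mono ?_ (measure_cthickening_ne_top (hM.cthickening.subset h5) _)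
    have h6 := Metric.cthickening_cthickening_subset (sub_nonneg.2 h3.le) h2 (Z n)
    rw [sub_add_cancel] at h6
    exact (Metric.cthickening_subset_of_subset _ h4).trans h6
  · filter_upwards [hrpos, hδ0, hZM] with n h1 h2 h5
    have hpos := mul_pos (unitBallVolume_pos (d - d')) (pow_pos h1 (d - d'))
    refine div_le_div_of_nonneg_right ?_ hpos.le
    refine measureReal_mono ?_ (measure_cthickening_ne_top hM _)
    exact (Metric.cthickening_subset_of_subset _ h5).trans
      (Metric.cthickening_cthickening_subset h1.le h2 M)

theorem frontier_cthickening_nonempty (hd : 0 < d) {M : Set (EuclideanSpace ℝ (Fin d))}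
    (hM : Bornology.IsBounded M) (hMne : M.Nonempty) (δ : ℝ) :
    (frontier (Metric.cthickening δ M)).Nonempty := by
  have : NeZero d := ⟨hd.ne'⟩
  refine nonempty_frontier_iff.2 ⟨hMne.mono (Metric.self_subset_cthickening M), fun h => ?_⟩
  have hb : Bornology.IsBounded (Metric.cthickening δ M) := hM.cthickening
  rw [h] at hb
  exact NoncompactSpace.noncompact_univ (Metric.isCompact_of_isClosed_isBounded isClosed_univ hb)

/-- The denoised sample approximates `M` at the rate of the estimators and of the sample. -/
theorem denoised_subset_and_subset_cthickening (hd : 0 < d)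
    {M : Set (EuclideanSpace ℝ (Fin d))} (hM : IsCompact M) (hMne : M.Nonempty)
    {R : ℝ} (hR : 0 < R) (hreach : ENNReal.ofReal R < reach M)
    {D : Set (EuclideanSpace ℝ (Fin d))} {a b e ε m R' lam : ℝ}
    (hD : Metric.hausdorffEDist D (frontier (Metric.cthickening R M)) < ENNReal.ofReal a)
    (hb : 0 < b) (hab : a = b ^ 3) (hRe : |R' - R| ≤ e) (hbm : b ≤ m) (hem : e ≤ m) (hεm : ε ≤ m)
    (hm1 : m ≤ 1) (hmR : m < R) (hlam : 0 < lam) (hlam1 : lam < 1) (hmlam : lam * R + 4 * m < R)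
    {proj : EuclideanSpace ℝ (Fin d) → EuclideanSpace ℝ (Fin d)}
    (hproj : D.Nonempty → ∀ x, IsMetricProjection D x (proj x))
    {n : ℕ} {y : Fin n → EuclideanSpace ℝ (Fin d)}
    (hyS : ∀ i, y i ∈ Metric.cthickening R M) (hyM : ∀ i, y i ∉ M)
    (hcov : ∀ x ∈ M, ∃ i, dist (y i) x ≤ 2 * ε) :
    denoised D R' lam proj y
        ⊆ Metric.cthickening (((2 * R + 3) * (1 + 2 / lam) + 11) * m) M ∧
      M ⊆ Metric.cthickening (((2 * R + 3) * (1 + 2 / lam) + 11) * m)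
        (denoised D R' lam proj y) := by
  -- The geometric lemmas need room above `R`, hence a level strictly between `R` and the reach.
  obtain ⟨ρ, -, hRρ, hρ⟩ := ENNReal.lt_iff_exists_real_btwn.1 hreach
  replace hRρ : R < ρ := (ENNReal.ofReal_lt_ofReal_iff_of_nonneg hR.le).1 hRρ
  have hfne := frontier_cthickening_nonempty hd hM.isBounded hMne R
  have ha : 0 < a := by rw [hab]; positivity
  have hb1 : b ≤ 1 := hbm.trans hm1
  have hab1 : a ≤ b := by
    rw [hab]
    exact pow_le_of_le_one hb.le hb1 (by norm_num)
  have hDne : D.Nonempty := by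
    obtain ⟨q, hq⟩ := hfne
    rw [Metric.hausdorffEDist_comm] at hD
    obtain ⟨x, hx, -⟩ := Metric.exists_edist_lt_of_hausdorffEDist_lt hq hD
    exact ⟨x, hx⟩
  have hm0 : 0 < m := hb.trans_le hbm
  have hC : 0 ≤ (2 * R + 3) * (1 + 2 / lam) := by positivity
  have hRe' := abs_le.1 hRe
  have hR'pos : 0 < R' := by linarith [hRe'.1]
  have hmain := fun i => exists_norm_denoised_sub_le hM hMne hR hRρ
    (fun w _ hw p hpM hp q hqM hq => eq_of_isMetricProjection_of_lt_reach
      ((ENNReal.ofReal_le_ofReal hw.le).trans_lt hρ) hpM hp hqM hq) hfne ha hD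
    (hproj hDne (y i)).1 (hproj hDne (y i)).2
    ((hM.isClosed.notMem_iff_infDist_pos hMne).1 (hyM i))
    ((mem_cthickening_iff_infDist_le hMne hR.le).1 (hyS i))
  constructor
  · rintro z ⟨i, hi, rfl⟩
    have hfar : lam * R' < ‖y i - proj (y i)‖ := by
      rw [← dist_eq_norm]
      exact hi.trans_le (Metric.infDist_le_dist_of_mem (hproj hDne (y i)).1)
    obtain ⟨p, hpM, hp⟩ := (hmain i).2.2 hb hb1 hab.le hRe hlam hR'pos hfar
    refine Metric.mem_cthickening_of_dist_le _ p _ _ hpM ?_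
    rw [dist_eq_norm]
    calc _ ≤ _ := hp
      _ ≤ ((2 * R + 3) * (1 + 2 / lam) + 5) * m + m := by gcongr
      _ ≤ _ := by linarith
  · intro x hx
    obtain ⟨i, hi⟩ := hcov x hx
    have ht : Metric.infDist (y i) M ≤ 2 * ε := (Metric.infDist_le_dist_of_mem hx).trans hi
    obtain ⟨h1, h2, -⟩ := hmain i
    have ht0 : 0 ≤ Metric.infDist (y i) M := Metric.infDist_nonneg
    have hR'lam : lam * R' ≤ lam * R + m := by nlinarith [hRe'.2]
    -- The `4 * m` in `hmlam` is `2 * ε + a ≤ 3 * m`, lost in the distance to `D`, plus `m` for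
    -- replacing `R` by `R'`.
    have hkeep : lam * R' < dist (y i) (proj (y i)) := by linarith
    have hdist : dist (y i) (proj (y i)) = Metric.infDist (y i) D :=
      le_antisymm ((Metric.le_infDist hDne).2 fun {q} hq => (hproj hDne (y i)).2 q hq)
        (Metric.infDist_le_dist_of_mem (hproj hDne (y i)).1)
    have hne : proj (y i) ≠ y i := fun h => by
      rw [h, dist_self] at hkeep
      exact absurd hkeep (not_lt.2 (mul_pos hlam hR'pos).le)
    refine Metric.mem_cthickening_of_dist_le _ _ _ _ ⟨i, hdist ▸ hkeep, rfl⟩ ?_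
    have h3 : dist (proj (y i) + (R' / ‖y i - proj (y i)‖) • (y i - proj (y i))) (y i)
        = |R' - dist (y i) (proj (y i))| := by
      rw [dist_eq_norm, dist_eq_norm]
      exact norm_add_div_smul_sub_sub (proj (y i)) (y i) hne R'
    have h4 : |R' - dist (y i) (proj (y i))| ≤ e + 2 * ε + a := by
      rw [abs_le]
      constructor <;> linarith [hRe'.1, hRe'.2]
    rw [dist_comm]
    calc _ ≤ _ := dist_triangle _ (y i) x
      _ ≤ (e + 2 * ε + a) + 2 * ε := add_le_add (h3.trans_le h4) hi
      _ ≤ _ := by nlinarith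

end Consistency

/-- Strong consistency of the estimator of the Minkowski content based on the denoised sample. -/
theorem theorem7
    {d d' : ℕ} (hd : d' < d)
    -- the set `M`, of reach larger than the noise level `R₁`, with finite Minkowski content `L₀`
    (M : Set (EuclideanSpace ℝ (Fin d))) (hM : IsCompact M) (hMne : M.Nonempty)
    (R₁ : ℝ) (hR₁ : 0 < R₁) (hreach : ENNReal.ofReal R₁ < reach M)
    (L₀ : ℝ) (hL₀ : HasMinkowskiContent d' M L₀)
    -- the iid sample; its law has support `S = B(M, R₁)` and a density `f ≥ f₀ > 0` on `S`
    {Ω : Type*} [MeasurableSpace Ω] (P : Measure Ω) [IsProbabilityMeasure P]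
    (Y : ℕ → Ω → EuclideanSpace ℝ (Fin d)) (hY : ∀ i, Measurable (Y i))
    (hindep : iIndepFun Y P)
    (f : EuclideanSpace ℝ (Fin d) → ℝ) (hf : Measurable f)
    (hlaw : ∀ i, P.map (Y i) = volume.withDensity (fun x => ENNReal.ofReal (f x)))
    (hsupp : ∀ i, (P.map (Y i)).support = Metric.cthickening R₁ M)
    (f₀ : ℝ) (hf₀ : 0 < f₀)
    (hff₀ : ∀ᵐ x ∂(volume.restrict (Metric.cthickening R₁ M)), f₀ ≤ f x)
    -- the estimators of `S` and `R₁`, with their rates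
    (Shat : (n : ℕ) → (Fin n → EuclideanSpace ℝ (Fin d)) → Set (EuclideanSpace ℝ (Fin d)))
    (Rhat : (n : ℕ) → (Fin n → EuclideanSpace ℝ (Fin d)) → ℝ)
    (a e : ℕ → ℝ) (ha : Tendsto a atTop (𝓝 0)) (he : Tendsto e atTop (𝓝 0))
    (hShat : ∀ᵐ ω ∂P, ∀ᶠ n in atTop,
      Metric.hausdorffEDist (frontier (Shat n (sample Y n ω)))
        (frontier (Metric.cthickening R₁ M)) < ENNReal.ofReal (a n))
    (hRhat : ∀ᵐ ω ∂P, ∀ᶠ n in atTop, |Rhat n (sample Y n ω) - R₁| ≤ e n)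
    -- the denoising parameter and the metric projection on the estimated boundary
    (lam : ℝ) (hlam : 0 < lam) (hlam1 : lam < 1)
    (proj : (n : ℕ) → (Fin n → EuclideanSpace ℝ (Fin d)) →
      EuclideanSpace ℝ (Fin d) → EuclideanSpace ℝ (Fin d))
    (hproj : ∀ (n : ℕ) (y : Fin n → EuclideanSpace ℝ (Fin d)),
      (frontier (Shat n y)).Nonempty →
        ∀ x, IsMetricProjection (frontier (Shat n y)) x (proj n y x))
    -- the rate `ε_n = c (log n / n)^{1/d}` and the radii `r_n`
    (c : ℝ) (hc : (6 / (f₀ * unitBallVolume d)) ^ (1 / (d : ℝ)) < c)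
    (r : ℕ → ℝ) (hrpos : ∀ᶠ n in atTop, 0 < r n) (hr : Tendsto r atTop (𝓝 0))
    (hrate : (fun n : ℕ => max (max (a n ^ (1 / 3 : ℝ)) (e n))
        (c * (Real.log n / n) ^ (1 / (d : ℝ)))) =o[atTop] r) :
    ∀ᵐ ω ∂P, Tendsto
      (fun n : ℕ => offsetRatio d'
        (denoised (frontier (Shat n (sample Y n ω))) (Rhat n (sample Y n ω)) lam
          (proj n (sample Y n ω)) (sample Y n ω)) (r n))
      atTop (𝓝 L₀) := by
  have hd0 : 0 < d := by omega
  have hdR : (0 : ℝ) < d := by exact_mod_cast hd0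
  have hω := unitBallVolume_pos d
  have hMb := hM.isBounded
  have hq : 0 < 6 / (f₀ * unitBallVolume d) := by positivity
  have hc0 : 0 < c := (Real.rpow_pos_of_pos hq _).trans hc
  -- The choice of `c` makes this product at least `6`; the value `3` is the exponent of the `n⁻³`
  -- bound in the covering lemma.
  have hcd : 3 ≤ f₀ * unitBallVolume d * c ^ d := by
    have h1 := pow_le_pow_left₀ (Real.rpow_pos_of_pos hq _).le hc.le d
    rw [← Real.rpow_natCast (_ ^ (1 / (d : ℝ))), ← Real.rpow_mul hq.le,
      one_div_mul_cancel hdR.ne', Real.rpow_one, div_le_iff₀ (by positivity)] at h1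
    linarith
  have hball : ∀ x ∈ M, ∀ ε, 0 < ε → ε ≤ R₁ → ∀ i,
      ENNReal.ofReal (f₀ * unitBallVolume d * ε ^ d) ≤ P (Y i ⁻¹' Metric.closedBall x ε) := by
    intro x hx ε hε hεR i
    -- A ball centred in `M` of radius at most `R₁` lies entirely in `S`, so the density bound holds
    -- on all of it.
    have hsub : Metric.closedBall x ε ⊆ Metric.cthickening R₁ M :=
      (Metric.closedBall_subset_closedBall hεR).trans (Metric.closedBall_subset_cthickening hx _)
    have hmeas : MeasurableSet (Metric.closedBall x ε) := Metric.isClosed_closedBall.measurableSet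
    rw [← Measure.map_apply (hY i) hmeas, hlaw i, withDensity_apply _ hmeas]
    calc ENNReal.ofReal (f₀ * unitBallVolume d * ε ^ d)
        = ∫⁻ _ in Metric.closedBall x ε, ENNReal.ofReal f₀ := by
          rw [setLIntegral_const, ← ofReal_measureReal measure_closedBall_lt_top.ne,
            ← ENNReal.ofReal_mul hf₀.le, volume_real_closedBall x hε.le]
          congr 1
          ring
      _ ≤ _ := lintegral_mono_ae ((ae_restrict_of_ae_restrict_of_subset hsub hff₀).mono
          fun w hw => ENNReal.ofReal_le_ofReal hw)
  have hYS : ∀ᵐ ω ∂P, ∀ i, Y i ω ∈ Metric.cthickening R₁ M := by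
    refine ae_all_iff.2 fun i => ?_
    have h : ∀ᵐ x ∂(P.map (Y i)), x ∈ (P.map (Y i)).support := Measure.support_mem_ae
    rw [hsupp i] at h
    exact ae_of_ae_map (hY i).aemeasurable h
  -- A finite content of dimension `d' < d` makes `M` negligible. Sample points off `M` have a
  -- well-defined direction away from their projection.
  have hYM : ∀ᵐ ω ∂P, ∀ i, Y i ω ∉ M := by
    refine ae_all_iff.2 fun i => ?_
    have h0 : P.map (Y i) M = 0 := by
      rw [hlaw i]
      exact withDensity_absolutelyContinuous _ _
        (measure_eq_zero_of_hasMinkowskiContent hd hMb hL₀)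
    exact ae_of_ae_map (hY i).aemeasurable (measure_eq_zero_iff_ae_notMem.1 h0)
  have hcov := ae_eventually_forall_exists_dist_le hd0 hMb hY hindep hR₁ hball hc0 hcd
  set m : ℕ → ℝ := fun n => max (max (a n ^ (1 / 3 : ℝ)) (e n))
    (c * (Real.log n / n) ^ (1 / (d : ℝ))) with hm
  have hm0 : Tendsto m atTop (𝓝 0) := hrate.isBigO.trans_tendsto hr
  have hsmall : ∀ κ > 0, ∀ᶠ n in atTop, m n < κ := fun κ hκ => hm0.eventually (Iio_mem_nhds hκ)
  have hlamR : 0 < (1 - lam) * R₁ / 4 := by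
    have := sub_pos.2 hlam1
    positivity
  set K := (2 * R₁ + 3) * (1 + 2 / lam) + 11 with hK
  have hK0 : 0 ≤ K := by positivity
  filter_upwards [hShat, hRhat, hYS, hYM, hcov] with ω hS hRh hyS hyM hcv
  -- A strict bound by `ENNReal.ofReal (a n)` forces `a n > 0`, so that `a n ^ (1 / 3)` is a genuine
  -- cube root, used below as `b`.
  have hapos : ∀ᶠ n in atTop, 0 < a n := hS.mono fun n hn =>
    ENNReal.ofReal_pos.1 (pos_of_gt hn)
  have hboth : ∀ᶠ n in atTop, denoised (frontier (Shat n (sample Y n ω)))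
        (Rhat n (sample Y n ω)) lam (proj n (sample Y n ω)) (sample Y n ω)
        ⊆ Metric.cthickening (K * m n) M ∧
      M ⊆ Metric.cthickening (K * m n) (denoised (frontier (Shat n (sample Y n ω)))
        (Rhat n (sample Y n ω)) lam (proj n (sample Y n ω)) (sample Y n ω)) := by
    filter_upwards [hS, hRh, hcv, hapos, hsmall 1 one_pos, hsmall R₁ hR₁, hsmall _ hlamR]
      with n h1 h2 h3 h4 h5 h6 h7
    refine denoised_subset_and_subset_cthickening hd0 hM hMne hR₁ hreach h1
      (Real.rpow_pos_of_pos h4 (1 / 3)) ?_ h2 ((le_max_left _ _).trans (le_max_left _ _))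
      ((le_max_right _ _).trans (le_max_left _ _)) (le_max_right _ _) h5.le h6 hlam hlam1
      (by linarith) (hproj n _) (fun i => hyS i) (fun i => hyM i) (fun x hx => ?_)
    · rw [← Real.rpow_natCast, ← Real.rpow_mul h4.le]
      norm_num
    · obtain ⟨i, hi, hix⟩ := h3 x hx
      exact ⟨⟨i, hi⟩, hix⟩
  refine tendsto_offsetRatio_of_subset_cthickening hMb hL₀ hrpos hr (hrate.const_mul_left K) ?_
    (hboth.mono fun n hn => hn.1) (hboth.mono fun n hn => hn.2)
  filter_upwards [hapos] with n hn
  exact mul_nonneg hK0 ((Real.rpow_pos_of_pos hn _).le.trans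
    ((le_max_left _ _).trans (le_max_left _ _)))
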